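/- Let $p$ be a prime and let $G$ be a finite $p$-group. Write $G=\gamma_1(G)\ge\gamma_2(G)\ge\gamma_3(G)\ge\cdots$ for the lower central series of $G$ (so $\gamma_2(G)$ is the commutator subgroup), $\Phi(G)$ for the Frattini subgroup, and $d(H)$ for the minimal number of generators of a finite group $H$. For $x\in G$ put $[x,G]=\{x^{-1}g^{-1}xg \mid g\in G\}$ (a set of commutators, not the subgroup they generate). The group $G$ is called of *Camina type* if it is non-abelian and $[x,G]=\gamma_2(G)$ for every $x\in G\setminus\Phi(G)$. Let $\operatorname{Aut}_c(G)$ be the group of all automorphisms $\alpha$ of $G$ such that $\alpha(x)$ is conjugate to $x$ in $G$ for every $x\in G$; the group $G$ *satisfies Hypothesis A* if $|\operatorname{Aut}_c(G)|=|\gamma_2(G)|^{d(G)}$. **Theorem.** Let $G$ be a finite $p$-group of Camina type whose nilpotency class is at least $3$. Then: (i) $d(G)=2\,d(\gamma_2(G)/\gamma_3(G))$; in particular $d(G)$ is even. (ii) If $\gamma_2(G)$ is cyclic, then $d(G)=2$. (iii) If $d(G)=2$ and $|\gamma_2(G)/\gamma_3(G)|>2$, then $\gamma_2(G)$ is cyclic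 and $G$ satisfies Hypothesis A. -/

import Mathlib

/-- The second term `γ₂(G)` of the lower central series, i.e. the commutator subgroup
(the lower central series of Mathlib is indexed from `0`). -/
abbrev gammaTwo (G : Type*) [Group G] : Subgroup G :=
  (⊤ : Subgroup G).lowerCentralSeries 1

/-- The third term `γ₃(G) = [γ₂(G), G]` of the lower central series. -/
abbrev gammaThree (G : Type*) [Group G] : Subgroup G :=
  (⊤ : Subgroup G).lowerCentralSeries 2

/-- The section `γ₂(G) / γ₃(G)` as a group. -/
abbrev GammaTwoModThree (G : Type*) [Group G] : Type _ :=
  gammaTwo G ⧸ (gammaThree G).subgroupOf (gammaTwo G)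

/-- The set `[x, G] = {[x, g] | g ∈ G}` of commutators `[x, g] = x⁻¹ g⁻¹ x g`
(a set, not the subgroup that it generates). -/
def commutatorsWith {G : Type*} [Group G] (x : G) : Set G :=
  {c | ∃ g : G, c = x⁻¹ * g⁻¹ * x * g}

/-- A group is of Camina type if it is non-abelian and `[x, G] = γ₂(G)` for all `x` outside the
Frattini subgroup. -/
structure IsCaminaType (G : Type*) [Group G] : Prop where
  nonabelian : ∃ a b : G, a * b ≠ b * a
  commutators_eq : ∀ x : G, x ∉ frattini G → commutatorsWith x = (gammaTwo G : Set G)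

/-- The group `Aut_c(G)` of automorphisms that map every element to a conjugate of itself. -/
def classPreservingAut (G : Type*) [Group G] : Subgroup (MulAut G) where
  carrier := {α | ∀ x : G, IsConj x (α x)}
  one_mem' := fun x => IsConj.refl x
  mul_mem' := fun {_ β} hα hβ x => (hβ x).trans (hα (β x))
  inv_mem' := fun {α} hα x => by
    have h := (hα (α⁻¹ x)).symm
    rwa [MulAut.apply_inv_self] at h

/-- A finite group `G` satisfies Hypothesis A if `|Aut_c(G)| = |γ₂(G)| ^ d(G)`. -/
def HypothesisA (G : Type*) [Group G] [Finite G] : Prop :=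
  Nat.card (classPreservingAut G) = Nat.card (gammaTwo G) ^ Group.rank G

/-! ### Alternating matrices and dimension bounds for vector-valued alternating forms. -/

section LinearAlgebra

open Module

/-! Let U = G/Φ(G) and let V be the Frattini quotient of γ₂/γ₃, both over `ZMod p`. Commutation
gives an alternating β : U × U → V, and the Camina condition says that β(x, ·) is onto for every x ≠
0. So (i) compares dimensions. For 2 dim V ≤ dim U, the Pfaffian of a generic functional composed
with β is a form of degree dim U / 2 in dim V variables with only the trivial zero, so
Chevalley–Warning bounds the number of variables. For the converse, pass to a quotient with |γ₃| =
p. Commutation with γ₂ is then a nonzero map T : U → V*, and by the three subgroups lemma ker T is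
isotropic for nondegenerate forms, which bounds dim U. Part (ii) is immediate, since then dim V ≤ 1.

For (iii), in the quotient with |γ₃| = p some c outside Φ(G) centralizes γ₂, so each element of γ₂
has the form y^i t^C(i,2) with t central of exponent p. Once |γ₂/γ₃| > 2, this makes γ₃ consist of
p-th powers of elements of γ₂. Hence γ₃ ≤ Φ(γ₂) in G, and γ₂ is cyclic because γ₂/γ₃ is. The action
on a cyclic γ₂ then yields a ∉ Φ(G) centralizing γ₂ in G itself, and for G = ⟨a, b⟩ inner
automorphisms already move (a, b) to every (ua, vb) with u, v ∈ γ₂. -/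

theorem Matrix.isSquare_det_of_alternating {K : Type*} [Field K] (n : ℕ) :
    ∀ {ι : Type} [Fintype ι] [DecidableEq ι] (_ : Fintype.card ι = n) (A : Matrix ι ι K)
      (_ : ∀ i, A i i = 0) (_ : ∀ i j, A j i = - A i j), IsSquare A.det := by
  induction n using Nat.strong_induction_on with
  | _ n ih =>
  intro ι _ _ hn A h0 hA
  by_cases hz : ∀ i j, A i j = 0
  · have : A = 0 := by ext i j; simpa using hz i j
    subst this
    rcases isEmpty_or_nonempty ι with h | h
    · simp
    · rw [Matrix.det_zero]; exact IsSquare.zero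
  push Not at hz
  obtain ⟨i, j, hij⟩ := hz
  have hne : i ≠ j := by rintro rfl; exact hij (h0 i)
  -- Move the nonzero entry into a leading 2 × 2 block, of determinant a². Its Schur complement is
  -- again alternating, and smaller.
  let κ := {x : ι // x ≠ i ∧ x ≠ j}
  let f : Fin 2 ⊕ κ → ι := Sum.elim ![i, j] Subtype.val
  have hf : Function.Bijective f := by
    constructor
    · refine Function.Injective.sumElim ?_ Subtype.val_injective ?_
      · intro x y h
        fin_cases x <;> fin_cases y
        · rfl
        · exact absurd h hne
        · exact absurd h.symm hne
        · rfl
      · rintro x ⟨y, hy⟩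
        fin_cases x
        · exact hy.1.symm
        · exact hy.2.symm
    · intro x
      by_cases h1 : x = i
      · exact ⟨Sum.inl 0, by simp [f, h1]⟩
      by_cases h2 : x = j
      · exact ⟨Sum.inl 1, by simp [f, h2]⟩
      exact ⟨Sum.inr ⟨x, h1, h2⟩, rfl⟩
  let e := Equiv.ofBijective f hf
  let B := A.submatrix e e
  have hB0 : ∀ i, B i i = 0 := fun i => h0 _
  have hBA : ∀ i j, B j i = - B i j := fun i j => hA _ _
  have ha : B (Sum.inl 0) (Sum.inl 1) ≠ 0 := hij
  have hdet : A.det = B.det := (Matrix.det_submatrix_equiv_self e A).symm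
  set a := B (Sum.inl 0) (Sum.inl 1) with ha_def
  have hM : B.toBlocks₁₁ = !![0, a; -a, 0] := by
    ext x y
    fin_cases x <;> fin_cases y <;> simp [Matrix.toBlocks₁₁, hB0]
    · rfl
    · rw [hBA]
  have hinv : Invertible B.toBlocks₁₁ :=
    ⟨!![0, -a⁻¹; a⁻¹, 0], by
      rw [hM]; ext x y; fin_cases x <;> fin_cases y <;> simp [Matrix.mul_apply, ha], by
      rw [hM]; ext x y; fin_cases x <;> fin_cases y <;> simp [Matrix.mul_apply, ha]⟩
  have hi : ⅟ B.toBlocks₁₁ = !![0, -a⁻¹; a⁻¹, 0] := by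
    apply invOf_eq_right_inv
    rw [hM]; ext x y; fin_cases x <;> fin_cases y <;> simp [Matrix.mul_apply, ha]
  have hS := Matrix.det_fromBlocks₁₁ B.toBlocks₁₁ B.toBlocks₁₂ B.toBlocks₂₁ B.toBlocks₂₂
  rw [Matrix.fromBlocks_toBlocks, hi] at hS
  rw [hdet, hS]
  apply IsSquare.mul
  · rw [hM, Matrix.det_fin_two]
    exact ⟨a, by simp⟩
  · have hcard : Fintype.card κ < n := by
      have := Fintype.card_congr e
      simp only [Fintype.card_sum, Fintype.card_fin] at this
      omega
    refine ih _ hcard rfl _ ?_ ?_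
    · intro x
      simp only [Matrix.sub_apply, Matrix.mul_apply, Fin.sum_univ_two, Matrix.toBlocks₂₂,
        Matrix.toBlocks₂₁, Matrix.toBlocks₁₂, Matrix.of_apply]
      simp only [Matrix.cons_val', Matrix.cons_val_zero, Matrix.cons_val_one,
        Matrix.cons_val_fin_one, hB0]
      rw [hBA (Sum.inl 1) (Sum.inr x), hBA (Sum.inl 0) (Sum.inr x)]
      ring
    · intro x y
      simp only [Matrix.sub_apply, Matrix.mul_apply, Fin.sum_univ_two, Matrix.toBlocks₂₂,
        Matrix.toBlocks₂₁, Matrix.toBlocks₁₂, Matrix.of_apply]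
      simp only [Matrix.cons_val', Matrix.cons_val_zero, Matrix.cons_val_one,
        Matrix.cons_val_fin_one]
      rw [hBA (Sum.inl 1) (Sum.inr x), hBA (Sum.inl 0) (Sum.inr x),
        hBA (Sum.inl 1) (Sum.inr y), hBA (Sum.inl 0) (Sum.inr y), hBA (Sum.inr x) (Sum.inr y)]
      ring

/-- Over an integrally closed domain, the determinant of an alternating matrix is a square. -/
theorem Matrix.isSquare_det_of_alternating_of_isIntegrallyClosed {R : Type*} [CommRing R]
    [IsDomain R] [IsIntegrallyClosed R] {ι : Type} [Fintype ι] [DecidableEq ι] (A : Matrix ι ι R)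
    (h0 : ∀ i, A i i = 0) (hA : ∀ i j, A j i = - A i j) : IsSquare A.det := by
  obtain ⟨r, hr⟩ := Matrix.isSquare_det_of_alternating (K := FractionRing R) _ rfl
    (A.map (algebraMap R (FractionRing R))) (by simp [h0])
    (fun i j => by simp [hA i j])
  rw [← RingHom.mapMatrix_apply, ← RingHom.map_det] at hr
  -- A square root in the fraction field of an element of R is integral over R, hence lies in R.
  have hint : IsIntegral R r := by
    refine IsIntegral.of_pow (n := 2) (by norm_num) ?_
    rw [sq, ← hr]
    exact isIntegral_algebraMap
  obtain ⟨y, rfl⟩ := IsIntegrallyClosed.isIntegral_iff.mp hint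
  refine ⟨y, ?_⟩
  apply IsFractionRing.injective R (FractionRing R)
  rw [hr, map_mul]

theorem MvPolynomial.totalDegree_det_le {R σ : Type*} [CommRing R] {ι : Type*} [Fintype ι]
    [DecidableEq ι] (A : Matrix ι ι (MvPolynomial σ R)) (d : ℕ)
    (hA : ∀ i j, (A i j).totalDegree ≤ d) : A.det.totalDegree ≤ Fintype.card ι * d := by
  rw [Matrix.det_apply]
  refine MvPolynomial.totalDegree_finsetSum_le fun τ _ => ?_
  refine (MvPolynomial.totalDegree_smul_le _ _).trans ?_
  refine (MvPolynomial.totalDegree_finsetProd _ _).trans ?_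
  refine (Finset.sum_le_sum fun i _ => hA _ _).trans ?_
  simp

variable {F : Type} [Field F] {U V : Type*} [AddCommGroup U] [AddCommGroup V]
  [Module F U] [Module F V] [FiniteDimensional F U] [FiniteDimensional F V]

/-- A vector-valued alternating form on `U` all of whose nonzero scalar components are
nondegenerate takes its values in a space of dimension at most half of `dim U`. -/
theorem two_mul_finrank_le_of_alternating [Finite F] (β : U →ₗ[F] U →ₗ[F] V)
    (hβ : ∀ x, β x x = 0) (hs : ∀ x, x ≠ 0 → Function.Surjective (β x))
    (hU : 0 < finrank F U) : 2 * finrank F V ≤ finrank F U := by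
  classical
  have : Fintype F := Fintype.ofFinite F
  by_contra! hlt
  have hβ' : ∀ x y, β y x = - β x y := fun x y => by
    have := hβ (x + y)
    simp only [map_add, LinearMap.add_apply, hβ, zero_add, add_zero] at this
    exact eq_neg_of_add_eq_zero_left this
  let bU := finBasis F U
  let bV := finBasis F V
  -- The Gram matrix of t ∘ β for a generic functional t on V: its entries are linear forms in the
  -- coordinates of t.
  let A : Matrix (Fin (finrank F U)) (Fin (finrank F U)) (MvPolynomial (Fin (finrank F V)) F) :=
    Matrix.of fun i j => ∑ k, MvPolynomial.C (bV.repr (β (bU i) (bU j)) k) * MvPolynomial.X k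
  obtain ⟨P, hP⟩ := Matrix.isSquare_det_of_alternating_of_isIntegrallyClosed A
    (fun i => by simp [A, hβ]) (fun i j => by simp [A, hβ' (bU i) (bU j)])
  have hdeg : A.det.totalDegree ≤ finrank F U := by
    have := MvPolynomial.totalDegree_det_le A 1 (fun i j => by
      simp only [A, Matrix.of_apply]
      refine MvPolynomial.totalDegree_finsetSum_le fun k _ => ?_
      refine (MvPolynomial.totalDegree_mul _ _).trans ?_
      simp)
    simpa using this
  -- A kernel vector x at t means that t vanishes on the image of β x, which is all of V; so the
  -- determinant vanishes only at t = 0.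
  have heval : ∀ t : Fin (finrank F V) → F, MvPolynomial.eval t A.det = 0 ↔ t = 0 := by
    intro t
    rw [RingHom.map_det, RingHom.mapMatrix_apply]
    constructor
    · intro h
      obtain ⟨v, hv, hv'⟩ := Matrix.exists_vecMul_eq_zero_iff.mpr h
      by_contra ht
      set x : U := ∑ i, v i • bU i with hx
      have hx0 : x ≠ 0 := by
        intro h
        apply hv
        have := Fintype.linearIndependent_iff.mp bU.linearIndependent v h
        ext i; exact this i
      let φ : V →ₗ[F] F := ∑ k, t k • bV.coord k
      have hφ : ∀ y, φ (β x y) = 0 := by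
        intro y
        have : φ ∘ₗ β x = 0 := by
          refine bU.ext fun j => ?_
          have h2 := congrFun hv' j
          simp only [Matrix.vecMul, dotProduct, Matrix.map_apply, A, Matrix.of_apply, map_sum, map_mul,
            MvPolynomial.eval_C, MvPolynomial.eval_X, Pi.zero_apply] at h2
          simp only [LinearMap.comp_apply, hx, map_sum, map_smul, LinearMap.sum_apply,
            LinearMap.smul_apply, φ, LinearMap.zero_apply, Basis.coord_apply, smul_eq_mul]
          rw [← h2]
          refine Finset.sum_congr rfl fun i _ => ?_
          congr 1
          exact Finset.sum_congr rfl fun k _ => by simp [mul_comm]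
        exact LinearMap.congr_fun this y
      apply ht
      ext k
      obtain ⟨y, hy⟩ := hs x hx0 (bV k)
      have := hφ y
      rw [hy] at this
      simpa [φ, Finsupp.single_apply] using this
    · rintro rfl
      have : (A.map ⇑(MvPolynomial.eval (0 : Fin (finrank F V) → F))) = 0 := by
        ext i j
        simp [A]
      have : Nonempty (Fin (finrank F U)) := ⟨⟨0, hU⟩⟩
      rw [‹A.map _ = 0›, Matrix.det_zero]
  have hP0 : P ≠ 0 := by
    rintro rfl
    have h1 := (heval (fun _ => 1)).mp (by rw [hP]; simp)
    have hV : 0 < finrank F V := by omega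
    simpa using congrFun h1 ⟨0, hV⟩
  rw [hP, MvPolynomial.totalDegree_mul_of_isDomain hP0 hP0] at hdeg
  -- Chevalley–Warning applies because 2 deg P ≤ dim U < 2 dim V; but P has exactly one zero.
  have hcw := char_dvd_card_solutions (p := ringChar F) (f := P) (by
    rw [Fintype.card_fin]; omega)
  have hone : Fintype.card {x : Fin (finrank F V) → F // MvPolynomial.eval x P = 0} = 1 := by
    rw [Fintype.card_eq_one_iff]
    refine ⟨⟨0, ?_⟩, fun x => Subtype.ext ?_⟩
    · have := (heval 0).mpr rfl
      rw [hP, map_mul] at this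
      exact mul_self_eq_zero.mp this
    · refine (heval _).mp ?_
      rw [hP, map_mul, x.2, zero_mul]
  rw [hone, Nat.dvd_one] at hcw
  exact CharP.ringChar_ne_one hcw

/-- If `C` is isotropic for a nondegenerate bilinear form, then `2 dim C ≤ dim U`. -/
theorem two_mul_finrank_le_of_isotropic (B : U →ₗ[F] Dual F U) (hB : Function.Injective B)
    (C : Submodule F U) (hC : ∀ x ∈ C, ∀ y ∈ C, B x y = 0) :
    2 * finrank F C ≤ finrank F U := by
  have h1 : C.map B ≤ C.dualAnnihilator := by
    rintro _ ⟨x, hx, rfl⟩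
    rw [Submodule.mem_dualAnnihilator]
    exact fun y hy => hC x hx y hy
  have h2 := Submodule.finrank_mono h1
  rw [← (Submodule.equivMapOfInjective B hB C).finrank_eq] at h2
  have := Subspace.finrank_add_finrank_dualAnnihilator_eq C
  omega

/-- If T z ≠ 0, the scalar form T z ∘ β is nondegenerate and ker T is isotropic for it, so ker T has
dimension at most dim U / 2. Its codimension is at most dim V. -/
theorem finrank_le_two_mul_of_alternating (β : U →ₗ[F] U →ₗ[F] V)
    (hs : ∀ x, x ≠ 0 → Function.Surjective (β x)) (T : U →ₗ[F] Dual F V) (hT : T ≠ 0)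
    (hiso : ∀ x ∈ LinearMap.ker T, ∀ y ∈ LinearMap.ker T, ∀ z, T z (β x y) = 0) :
    finrank F U ≤ 2 * finrank F V := by
  obtain ⟨z, hz⟩ : ∃ z, T z ≠ 0 := by
    by_contra! h
    exact hT (LinearMap.ext h)
  have h1 := two_mul_finrank_le_of_isotropic (β.compr₂ (T z)) (by
    rw [injective_iff_map_eq_zero]
    intro x hx
    by_contra hx0
    apply hz
    ext v
    obtain ⟨y, rfl⟩ := hs x hx0 v
    exact LinearMap.congr_fun hx y) (LinearMap.ker T) (fun x hx y hy => hiso x hx y hy z)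
  have h2 := LinearMap.finrank_range_add_finrank_ker T
  have h3 : finrank F (LinearMap.range T) ≤ finrank F (Dual F V) := Submodule.finrank_le _
  rw [Subspace.dual_finrank_eq] at h3
  omega

end LinearAlgebra

/-! ### The Frattini quotient of a finite p-group as a vector space. -/

section FrattiniOfPGroup

open Module

variable {p : ℕ} [Fact p.Prime] {G : Type*} [Group G] [Finite G]

/-- In a finite `p`-group, every proper subgroup is contained in a subgroup of index `p`. -/
theorem IsPGroup.exists_index_eq_of_ne_top (hp : IsPGroup p G) {M : Subgroup G} (hM : M ≠ ⊤) :
    ∃ K : Subgroup G, M ≤ K ∧ K.index = p := by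
  obtain ⟨k, hk⟩ := IsPGroup.iff_card.mp hp
  obtain ⟨j, hj⟩ := IsPGroup.iff_card.mp (hp.to_subgroup M)
  have hpp : 1 < p := (Fact.out : p.Prime).one_lt
  have hjk : j < k := by
    refine lt_of_le_of_ne ?_ fun h => hM (Subgroup.eq_top_of_card_eq M (by rw [hj, hk, h]))
    rw [← Nat.pow_dvd_pow_iff_le_right hpp, ← hj, ← hk]
    exact M.card_subgroup_dvd_card
  obtain ⟨K, hK, hMK⟩ := Sylow.exists_subgroup_card_pow_prime_le (G := G) p (m := k - 1)
    (by rw [hk]; exact pow_dvd_pow _ (by omega)) M hj (by omega)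
  refine ⟨K, hMK, ?_⟩
  have h := K.card_mul_index
  rw [hK, hk, show p ^ k = p ^ (k - 1) * p by rw [← pow_succ]; congr 1; omega] at h
  exact Nat.eq_of_mul_eq_mul_left (by positivity) h

theorem IsPGroup.index_of_isCoatom (hp : IsPGroup p G) {M : Subgroup G} (hM : IsCoatom M) :
    M.index = p := by
  obtain ⟨K, hMK, hK⟩ := hp.exists_index_eq_of_ne_top hM.1
  rcases eq_or_lt_of_le hMK with rfl | h
  · exact hK
  · rw [hM.2 K h, Subgroup.index_top] at hK
    exact absurd hK.symm (Fact.out : p.Prime).ne_one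

theorem IsPGroup.normal_of_isCoatom (hp : IsPGroup p G) {M : Subgroup G} (hM : IsCoatom M) :
    M.Normal :=
  have := hp.isNilpotent
  Subgroup.NormalizerCondition.normal_of_coatom M Group.normalizerCondition_of_isNilpotent hM

theorem IsPGroup.pow_mem_frattini (hp : IsPGroup p G) (x : G) : x ^ p ∈ frattini G := by
  rw [frattini, Order.radical]
  simp only [Subgroup.mem_iInf]
  intro M hM
  have := hp.normal_of_isCoatom hM
  rw [← hp.index_of_isCoatom hM]
  exact Subgroup.pow_index_mem M x

theorem IsPGroup.commutator_le_frattini (hp : IsPGroup p G) : commutator G ≤ frattini G := by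
  rw [frattini, Order.radical]
  simp only [le_iInf_iff]
  intro M hM
  have := hp.normal_of_isCoatom hM
  rw [← Subgroup.Normal.quotient_commutative_iff_commutator_le]
  have hc : IsCyclic (G ⧸ M) := isCyclic_of_prime_card (p := p) (hp.index_of_isCoatom hM)
  exact ⟨⟨hc.commGroup.mul_comm⟩⟩

theorem IsPGroup.gammaTwo_le_frattini (hp : IsPGroup p G) : gammaTwo G ≤ frattini G := by
  rw [gammaTwo, Subgroup.top_lowerCentralSeries_one]
  exact hp.commutator_le_frattini

/-- Subgroups are subspaces, so the Frattini subgroup has a complement; being made of nongenerators,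
it is trivial. -/
theorem frattini_eq_bot_of_exponent_prime {E : Type*} [CommGroup E] [Finite E]
    (hE : ∀ x : E, x ^ p = 1) : frattini E = ⊥ := by
  let : Module (ZMod p) (Additive E) := AddCommGroup.zmodModule (n := p) (fun x => hE x.toMul)
  have e : Subgroup E ≃o Submodule (ZMod p) (Additive E) :=
    Subgroup.toAddSubgroup.trans (AddSubgroup.toZModSubmodule p)
  have : ComplementedLattice (Subgroup E) := e.complementedLattice_iff.mpr inferInstance
  obtain ⟨K, hK⟩ := exists_isCompl (frattini E)
  have h1 := hK.sup_eq_top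
  rw [sup_comm] at h1
  have h2 := hK.inf_eq_bot
  rwa [frattini_nongenerating h1, inf_top_eq] at h2

/-- This is what lets maps that are multiplicative in one variable descend to the Frattini quotient.
-/
theorem frattini_le_ker_of_exponent_prime {E : Type*} [CommGroup E] (hE : ∀ x : E, x ^ p = 1)
    (f : G →* E) : frattini G ≤ f.ker := by
  have : Finite f.range := Finite.of_surjective _ f.rangeRestrict_surjective
  have h := frattini_le_comap_frattini_of_surjective f.rangeRestrict_surjective
  rw [frattini_eq_bot_of_exponent_prime (p := p)
    (fun x => Subtype.ext (by simpa using hE x))] at h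
  rw [← f.ker_rangeRestrict]
  exact h

theorem exists_mulEquiv_of_exponent_prime (p : ℕ) [Fact p.Prime] {E : Type*} [CommGroup E]
    [Finite E] (hE : ∀ x : E, x ^ p = 1) :
    ∃ (k : ℕ) (e : E →* Multiplicative (Fin k → ZMod p)), Function.Bijective e := by
  let : Module (ZMod p) (Additive E) := AddCommGroup.zmodModule (n := p) (fun x => hE x.toMul)
  have : Module.Finite (ZMod p) (Additive E) := Module.Finite.of_finite
  let b : Basis _ (ZMod p) (Additive E) := Module.finBasis (ZMod p) (Additive E)
  exact ⟨_, AddMonoidHom.toMultiplicativeRight b.equivFun.toLinearMap.toAddMonoidHom,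
    b.equivFun.bijective⟩

/-- The Frattini quotient of a finite `p`-group, as a vector space over `ZMod p`. -/
theorem IsPGroup.exists_frattini_coordinates (hp : IsPGroup p G) :
    ∃ (k : ℕ) (π : G →* Multiplicative (Fin k → ZMod p)),
      Function.Surjective π ∧ π.ker = frattini G := by
  let : CommGroup (G ⧸ frattini G) :=
    { (inferInstance : Group (G ⧸ frattini G)) with
      mul_comm :=
        (Subgroup.Normal.quotient_commutative_iff_commutator_le.mpr hp.commutator_le_frattini).1.1 }
  obtain ⟨k, e, he⟩ := exists_mulEquiv_of_exponent_prime p (E := G ⧸ frattini G) (fun x => by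
    obtain ⟨g, rfl⟩ := QuotientGroup.mk_surjective x
    exact (QuotientGroup.eq_one_iff _).mpr (hp.pow_mem_frattini g))
  refine ⟨k, e.comp (QuotientGroup.mk' _), he.2.comp (QuotientGroup.mk'_surjective _), ?_⟩
  rw [← MonoidHom.comap_ker, (MonoidHom.ker_eq_bot_iff e).mpr he.1, MonoidHom.comap_bot,
    QuotientGroup.ker_mk']

theorem closure_eq_top_of_span_eq_top {U : Type*} [AddCommGroup U] [Module (ZMod p) U]
    {π : G →* Multiplicative U} (hk : π.ker ≤ frattini G) (S : Set G)
    (hS : Submodule.span (ZMod p) ((fun x => (π x).toAdd) '' S) = ⊤) :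
    Subgroup.closure S = ⊤ := by
  apply frattini_nongenerating
  rw [eq_top_iff]
  refine le_trans ?_ (sup_le_sup_left hk _)
  rw [← Subgroup.comap_map_eq]
  intro x _
  rw [Subgroup.mem_comap]
  have hle : Submodule.span (ZMod p) ((fun x => (π x).toAdd) '' S) ≤
      AddSubgroup.toZModSubmodule p (Subgroup.toAddSubgroup'
        ((Subgroup.closure S).map π)) := by
    rw [Submodule.span_le]
    rintro _ ⟨s, hs, rfl⟩
    exact Subgroup.mem_map_of_mem π (Subgroup.subset_closure hs)
  rw [hS] at hle
  exact hle (x := (π x).toAdd) trivial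

theorem span_eq_top_of_closure_eq_top {H U : Type*} [Group H] [AddCommGroup U] [Module (ZMod p) U]
    {π : H →* Multiplicative U} (hs : Function.Surjective π) (S : Set H)
    (hS : Subgroup.closure S = ⊤) :
    Submodule.span (ZMod p) ((fun x => (π x).toAdd) '' S) = ⊤ := by
  rw [eq_top_iff]
  rintro u -
  obtain ⟨x, rfl⟩ := hs (Multiplicative.ofAdd u)
  have hx : x ∈ Subgroup.closure S := hS ▸ Subgroup.mem_top x
  change (π x).toAdd ∈ _
  induction hx using Subgroup.closure_induction with
  | mem x hx => exact Submodule.subset_span ⟨x, hx, rfl⟩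
  | one => rw [map_one]; exact Submodule.zero_mem _
  | mul x y _ _ hx hy => rw [map_mul]; exact Submodule.add_mem _ hx hy
  | inv x _ hx => rw [map_inv]; exact Submodule.neg_mem _ hx

/-- Burnside's basis theorem: lifts of a basis generate, because the kernel consists of
nongenerators. -/
theorem rank_eq_finrank_of_ker_le_frattini {U : Type*} [AddCommGroup U] [Module (ZMod p) U]
    {π : G →* Multiplicative U} (hs : Function.Surjective π) (hk : π.ker ≤ frattini G) :
    Group.rank G = finrank (ZMod p) U := by
  classical
  have hUf : Finite U := Finite.of_surjective π hs
  apply le_antisymm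
  · let b := finBasis (ZMod p) U
    choose g hg using fun i => hs (Multiplicative.ofAdd (b i))
    have hspan := closure_eq_top_of_span_eq_top (p := p) hk (Set.range g) (by
      rw [← Set.range_comp]
      convert b.span_eq using 3
      ext i
      simp [hg])
    have h := Group.rank_le (S := Finset.univ.image g) (by simpa using hspan)
    exact h.trans (Finset.card_image_le.trans (by simp))
  · obtain ⟨S, hS, hS'⟩ := Group.rank_spec G
    have h := span_eq_top_of_closure_eq_top (p := p) hs _ hS'
    rw [← hS, ← finrank_top, ← h]
    have h2 := finrank_span_finset_le_card (R := ZMod p) (S.image fun x => (π x).toAdd)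
    rw [Finset.coe_image] at h2
    exact h2.trans Finset.card_image_le

theorem IsPGroup.exists_frattini_coordinates_rank (hp : IsPGroup p G) :
    ∃ π : G →* Multiplicative (Fin (Group.rank G) → ZMod p),
      Function.Surjective π ∧ π.ker = frattini G := by
  obtain ⟨k, π, hs, hk⟩ := hp.exists_frattini_coordinates
  have h := rank_eq_finrank_of_ker_le_frattini (p := p) hs hk.le
  rw [finrank_fin_fun] at h
  subst h
  exact ⟨π, hs, hk⟩

/-- In a two-generator finite `p`-group, an element outside the Frattini subgroup is part of a
generating pair. -/
theorem IsPGroup.exists_closure_pair_eq_top (hp : IsPGroup p G) (hr : Group.rank G = 2) {a : G}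
    (ha : a ∉ frattini G) : ∃ b, Subgroup.closure {a, b} = (⊤ : Subgroup G) := by
  obtain ⟨π, hs, hk⟩ := hp.exists_frattini_coordinates_rank
  have hdim : finrank (ZMod p) (Fin (Group.rank G) → ZMod p) = 2 := by simp [hr]
  have hne : (π a).toAdd ≠ 0 := fun h => ha (hk ▸ h)
  obtain ⟨v, hv⟩ : ∃ v, v ∉ Submodule.span (ZMod p) {(π a).toAdd} := by
    by_contra! h
    have h1 : Submodule.span (ZMod p) {(π a).toAdd} = ⊤ := by ext; simp [h]
    have h2 := finrank_span_singleton (K := ZMod p) hne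
    rw [h1, finrank_top, hdim] at h2
    omega
  obtain ⟨b, hb⟩ := hs (Multiplicative.ofAdd v)
  refine ⟨b, closure_eq_top_of_span_eq_top (p := p) hk.le _ ?_⟩
  have hli : LinearIndependent (ZMod p) ![(π a).toAdd, v] := by
    rw [LinearIndependent.pair_iff' hne]
    intro c hc
    exact hv (hc ▸ Submodule.smul_mem _ _ (Submodule.mem_span_singleton_self _))
  have := hli.span_eq_top_of_card_eq_finrank (by rw [hdim]; simp)
  rw [← this]
  congr 1
  rw [Set.image_pair, hb]
  ext x
  simp [eq_comm, or_comm]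

theorem rank_quotient_of_le_frattini (hp : IsPGroup p G) (N : Subgroup G) [N.Normal]
    (hN : N ≤ frattini G) : Group.rank (G ⧸ N) = Group.rank G := by
  obtain ⟨π, hs, hk⟩ := (hp.to_quotient N).exists_frattini_coordinates_rank
  have hs' : Function.Surjective (π.comp (QuotientGroup.mk' N)) :=
    hs.comp (QuotientGroup.mk'_surjective N)
  refine le_antisymm (Group.rank_le_of_surjective _ (QuotientGroup.mk'_surjective N)) ?_
  obtain ⟨S, hS, hS'⟩ := Group.rank_spec (G ⧸ N)
  classical
  choose s hs using QuotientGroup.mk'_surjective N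
  rw [← hS]
  refine (Group.rank_le (S := S.image s) ?_).trans Finset.card_image_le
  apply frattini_nongenerating
  rw [eq_top_iff]
  refine le_trans ?_ (sup_le_sup_left hN _)
  nth_rw 2 [← QuotientGroup.ker_mk' N]
  rw [← Subgroup.comap_map_eq, MonoidHom.map_closure, Finset.coe_image, ← Set.image_comp]
  have : (QuotientGroup.mk' N) ∘ s = id := funext hs
  rw [this, Set.image_id, hS']
  simp

theorem MonoidHom.exists_linearMap_of_ker_le {U W H : Type*} [Group H] [AddCommGroup U]
    [Module (ZMod p) U] [AddCommGroup W] [Module (ZMod p) W] {π : H →* Multiplicative U}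
    (hs : Function.Surjective π) (f : H →* Multiplicative W) (hf : π.ker ≤ f.ker) :
    ∃ g : U →ₗ[ZMod p] W, ∀ x, g (π x).toAdd = (f x).toAdd := by
  let g := π.liftOfRightInverse _ (Function.rightInverse_surjInv hs) ⟨f, hf⟩
  refine ⟨(AddMonoidHom.toMultiplicative.symm g : U →+ W).toZModLinearMap p, fun x => ?_⟩
  exact congrArg Multiplicative.toAdd
    (MonoidHom.liftOfRightInverse_comp_apply π _ (Function.rightInverse_surjInv hs) ⟨f, hf⟩ x)

theorem exists_bilinear_of_biadditive {U U' W H H' : Type*} [Group H] [Group H'] [AddCommGroup U]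
    [Module (ZMod p) U] [AddCommGroup U'] [Module (ZMod p) U'] [AddCommGroup W]
    [Module (ZMod p) W] {π : H →* Multiplicative U} (hs : Function.Surjective π)
    {π' : H' →* Multiplicative U'} (hs' : Function.Surjective π') (c : H → H' → W)
    (hl : ∀ x y z, c (x * y) z = c x z + c y z) (hr : ∀ x y z, c x (y * z) = c x y + c x z)
    (hk : ∀ x ∈ π.ker, ∀ y, c x y = 0) (hk' : ∀ y ∈ π'.ker, ∀ x, c x y = 0) :
    ∃ β : U →ₗ[ZMod p] U' →ₗ[ZMod p] W, ∀ x y, β (π x).toAdd (π' y).toAdd = c x y := by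
  have h1 : ∀ x, ∃ g : U' →ₗ[ZMod p] W, ∀ y, g (π' y).toAdd = c x y := fun x =>
    MonoidHom.exists_linearMap_of_ker_le hs'
      (MonoidHom.mk' (fun y => Multiplicative.ofAdd (c x y)) (fun y z => by rw [hr]; rfl))
      (fun y hy => hk' y hy x)
  choose g hg using h1
  obtain ⟨β, hβ⟩ := MonoidHom.exists_linearMap_of_ker_le (p := p) hs
    (MonoidHom.mk' (fun x => Multiplicative.ofAdd (g x)) (fun x y => by
      rw [← ofAdd_add]
      congr 1
      ext u
      obtain ⟨z, rfl⟩ := hs' (Multiplicative.ofAdd u)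
      change g (x * y) (π' z).toAdd = g x (π' z).toAdd + g y (π' z).toAdd
      rw [hg, hg, hg, hl]))
    (fun x hx => by
      change g x = 0
      ext u
      obtain ⟨z, hz⟩ := hs' (Multiplicative.ofAdd u)
      have : u = (π' z).toAdd := by rw [hz]; rfl
      rw [this, hg, hk x hx]; rfl)
  refine ⟨β, fun x y => ?_⟩
  rw [hβ]
  exact hg x y

end FrattiniOfPGroup

/-! ### Commutator forms and the two inequalities between the ranks. -/

section CommutatorForms

open Module Subgroup
open scoped commutatorElement

variable {p : ℕ} [Fact p.Prime] {G : Type*} [Group G]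

theorem commutatorElement_mem_gammaTwo (x y : G) : ⁅x, y⁆ ∈ gammaTwo G :=
  commutator_mem_commutator (mem_top x) (mem_top y)

theorem commutatorElement_mem_gammaThree {w : G} (hw : w ∈ gammaTwo G) (y : G) :
    ⁅w, y⁆ ∈ gammaThree G :=
  commutator_mem_commutator hw (mem_top y)

theorem commutatorElement_mem_gammaThree' {w : G} (hw : w ∈ gammaTwo G) (y : G) :
    ⁅y, w⁆ ∈ gammaThree G := by
  rw [← commutatorElement_inv]
  exact inv_mem (commutatorElement_mem_gammaThree hw y)

theorem gammaThree_le_gammaTwo : gammaThree G ≤ gammaTwo G :=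
  (⊤ : Subgroup G).lowerCentralSeries_antitone (by norm_num)

theorem IsCaminaType.exists_commutator_eq (hG : IsCaminaType G) {x w : G} (hx : x ∉ frattini G)
    (hw : w ∈ gammaTwo G) : ∃ g, ⁅x, g⁆ = w := by
  -- The two commutator conventions differ by inverting both arguments: ⁅x, g⁆ = x g x⁻¹ g⁻¹.
  have h := hG.commutators_eq x⁻¹ (fun h => hx (by simpa using inv_mem h))
  obtain ⟨g, hg⟩ : w ∈ commutatorsWith x⁻¹ := h ▸ hw
  exact ⟨g⁻¹, by rw [hg, commutatorElement_def]; group⟩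

/-- G acts trivially on γ₂/γ₃; this removes the conjugations from the commutator identities for
products. -/
theorem map_mk_conj_eq {M : Type*} [Group M] {f : gammaTwo G →* M}
    (hf : ∀ w : gammaTwo G, (w : G) ∈ gammaThree G → f w = 1) (a : G) {w : G}
    (hw : w ∈ gammaTwo G) (hw' : a * w * a⁻¹ ∈ gammaTwo G) :
    f ⟨a * w * a⁻¹, hw'⟩ = f ⟨w, hw⟩ := by
  have h : (⟨a * w * a⁻¹, hw'⟩ : gammaTwo G) =
      ⟨⁅a, w⁆, commutatorElement_mem_gammaTwo a w⟩ * ⟨w, hw⟩ := by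
    ext
    change a * w * a⁻¹ = ⁅a, w⁆ * w
    rw [commutatorElement_def, inv_mul_cancel_right]
  rw [h, map_mul, hf _ (commutatorElement_mem_gammaThree' hw a), one_mul]

variable [Finite G] {U V : Type*} [AddCommGroup U] [Module (ZMod p) U] [AddCommGroup V]
  [Module (ZMod p) V]

theorem pow_prime_eq_one_of_module (x : Multiplicative V) : x ^ p = 1 := by
  change p • x.toAdd = 0
  rw [← Nat.cast_smul_eq_nsmul (ZMod p)]
  simp

/-- The commutator map as an alternating form on the Frattini quotient. -/
theorem exists_commutator_form {π : G →* Multiplicative U} (hs : Function.Surjective π)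
    (hk : π.ker ≤ frattini G) (ρ : gammaTwo G →* Multiplicative V)
    (hρ : ∀ w : gammaTwo G, (w : G) ∈ gammaThree G → ρ w = 1) :
    ∃ β : U →ₗ[ZMod p] U →ₗ[ZMod p] V, ∀ x y, β (π x).toAdd (π y).toAdd =
      (ρ ⟨⁅x, y⁆, commutatorElement_mem_gammaTwo x y⟩).toAdd := by
  have hl : ∀ x y z : G, ρ ⟨⁅x * y, z⁆, commutatorElement_mem_gammaTwo _ _⟩ =
      ρ ⟨⁅x, z⁆, commutatorElement_mem_gammaTwo _ _⟩ *
      ρ ⟨⁅y, z⁆, commutatorElement_mem_gammaTwo _ _⟩ := fun x y z => by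
    have hc : x * ⁅y, z⁆ * x⁻¹ ∈ gammaTwo G :=
      Normal.conj_mem inferInstance _ (commutatorElement_mem_gammaTwo y z) x
    rw [← map_mk_conj_eq hρ x (commutatorElement_mem_gammaTwo y z) hc, mul_comm, ← map_mul]
    congr 2
    simp only [commutatorElement_def]
    group
  have hr : ∀ x y z : G, ρ ⟨⁅x, y * z⁆, commutatorElement_mem_gammaTwo _ _⟩ =
      ρ ⟨⁅x, y⁆, commutatorElement_mem_gammaTwo _ _⟩ *
      ρ ⟨⁅x, z⁆, commutatorElement_mem_gammaTwo _ _⟩ := fun x y z => by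
    have hc : y * ⁅x, z⁆ * y⁻¹ ∈ gammaTwo G :=
      Normal.conj_mem inferInstance _ (commutatorElement_mem_gammaTwo x z) y
    rw [← map_mk_conj_eq hρ y (commutatorElement_mem_gammaTwo x z) hc, ← map_mul]
    congr 2
    simp only [commutatorElement_def]
    group
  refine exists_bilinear_of_biadditive hs hs
    (fun x y => (ρ ⟨⁅x, y⁆, commutatorElement_mem_gammaTwo x y⟩).toAdd)
    (fun x y z => by rw [hl]; rfl) (fun x y z => by rw [hr]; rfl) ?_ ?_
  · intro x hx y
    exact frattini_le_ker_of_exponent_prime (p := p) pow_prime_eq_one_of_module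
      (MonoidHom.mk' (fun x => ρ ⟨⁅x, y⁆, commutatorElement_mem_gammaTwo x y⟩)
        (fun a b => hl a b y)) (hk hx)
  · intro y hy x
    exact frattini_le_ker_of_exponent_prime (p := p) pow_prime_eq_one_of_module
      (MonoidHom.mk' (fun y => ρ ⟨⁅x, y⁆, commutatorElement_mem_gammaTwo x y⟩)
        (fun a b => hr x a b)) (hk hy)

/-- Commutation with elements of `γ₂(G)` as a bilinear form, when `γ₃(G)` is central. -/
theorem exists_gammaThree_form {π : G →* Multiplicative U} (hs : Function.Surjective π)
    (hk : π.ker ≤ frattini G) {σ : GammaTwoModThree G →* Multiplicative V}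
    (hs' : Function.Surjective σ) (hk' : σ.ker ≤ frattini (GammaTwoModThree G))
    (hc : gammaThree G ≤ center G) (μ : gammaThree G →* Multiplicative (ZMod p)) :
    ∃ T : U →ₗ[ZMod p] V →ₗ[ZMod p] ZMod p, ∀ (z : G) (w : gammaTwo G),
      T (π z).toAdd (σ (QuotientGroup.mk w)).toAdd =
        (μ ⟨⁅(w : G), z⁆, commutatorElement_mem_gammaThree w.2 z⟩).toAdd := by
  have hcen : ∀ {t : G}, t ∈ gammaThree G → ∀ x, t * x = x * t := fun ht x =>
    (mem_center_iff.mp (hc ht) x).symm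
  have hl : ∀ (w w' : gammaTwo G) (z : G),
      μ ⟨⁅((w * w' : gammaTwo G) : G), z⁆, commutatorElement_mem_gammaThree (w * w').2 z⟩ =
      μ ⟨⁅(w : G), z⁆, commutatorElement_mem_gammaThree w.2 z⟩ *
      μ ⟨⁅(w' : G), z⁆, commutatorElement_mem_gammaThree w'.2 z⟩ := fun w w' z => by
    rw [mul_comm, ← map_mul]
    congr 1
    ext
    have h := hcen (commutatorElement_mem_gammaThree w'.2 z) w
    have h2 : ⁅(w : G) * w', z⁆ = w * ⁅(w' : G), z⁆ * (w : G)⁻¹ * ⁅(w : G), z⁆ := by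
      simp only [commutatorElement_def]; group
    change ⁅(w : G) * w', z⁆ = ⁅(w' : G), z⁆ * ⁅(w : G), z⁆
    rw [h2, ← h, mul_inv_cancel_right]
  have hr : ∀ (w : gammaTwo G) (z z' : G),
      μ ⟨⁅(w : G), z * z'⁆, commutatorElement_mem_gammaThree w.2 _⟩ =
      μ ⟨⁅(w : G), z⁆, commutatorElement_mem_gammaThree w.2 z⟩ *
      μ ⟨⁅(w : G), z'⁆, commutatorElement_mem_gammaThree w.2 z'⟩ := fun w z z' => by
    rw [← map_mul]
    congr 1
    ext
    have h := hcen (commutatorElement_mem_gammaThree w.2 z') z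
    have h2 : ⁅(w : G), z * z'⁆ = ⁅(w : G), z⁆ * (z * ⁅(w : G), z'⁆ * z⁻¹) := by
      simp only [commutatorElement_def]; group
    change ⁅(w : G), z * z'⁆ = ⁅(w : G), z⁆ * ⁅(w : G), z'⁆
    rw [h2, ← h, mul_inv_cancel_right]
  have hs'' : Function.Surjective (σ.comp (QuotientGroup.mk' _)) :=
    hs'.comp (QuotientGroup.mk'_surjective _)
  refine exists_bilinear_of_biadditive hs hs''
    (fun z w => (μ ⟨⁅(w : G), z⁆, commutatorElement_mem_gammaThree w.2 z⟩).toAdd)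
    (fun x y z => by rw [hr]; rfl) (fun x y z => by rw [hl]; rfl) ?_ ?_
  · intro x hx w
    exact frattini_le_ker_of_exponent_prime (p := p) pow_prime_eq_one_of_module
      (MonoidHom.mk' (fun z => μ ⟨⁅(w : G), z⁆, commutatorElement_mem_gammaThree w.2 z⟩)
        (fun a b => hr w a b)) (hk hx)
  · intro w hw z
    let f : GammaTwoModThree G →* Multiplicative (ZMod p) := QuotientGroup.lift _
      (MonoidHom.mk' (fun w : gammaTwo G =>
        μ ⟨⁅(w : G), z⁆, commutatorElement_mem_gammaThree w.2 z⟩) (fun a b => hl a b z)) (by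
        intro t ht
        have h1 : ⁅(t : G), z⁆ = 1 := commutatorElement_eq_one_iff_mul_comm.mpr (hcen ht z)
        change μ ⟨⁅(t : G), z⁆, _⟩ = 1
        simp only [h1]
        exact μ.map_one)
    exact frattini_le_ker_of_exponent_prime (p := p) pow_prime_eq_one_of_module f (hk' hw)

theorem IsCaminaType.rank_pos (hG : IsCaminaType G) : 0 < Group.rank G := by
  have : Nontrivial G := by
    obtain ⟨a, b, hab⟩ := hG.nonabelian
    exact ⟨a * b, b * a, hab⟩
  exact Group.rank_pos G

theorem isPGroup_gammaTwoModThree {p : ℕ} {G : Type*} [Group G]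
    (hp : IsPGroup p G) : IsPGroup p (GammaTwoModThree G) :=
  (hp.to_subgroup _).to_quotient _

/-- The commutator form of a group of Camina type, in coordinates. -/
theorem IsCaminaType.exists_form (hG : IsCaminaType G) {π : G →* Multiplicative U}
    (hs : Function.Surjective π) (hk : π.ker = frattini G)
    {σ : GammaTwoModThree G →* Multiplicative V} (hs' : Function.Surjective σ) :
    ∃ β : U →ₗ[ZMod p] U →ₗ[ZMod p] V, (∀ x y, β (π x).toAdd (π y).toAdd =
      (σ (QuotientGroup.mk ⟨⁅x, y⁆, commutatorElement_mem_gammaTwo x y⟩)).toAdd) ∧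
      (∀ u, β u u = 0) ∧ ∀ u, u ≠ 0 → Function.Surjective (β u) := by
  obtain ⟨β, hβ⟩ := exists_commutator_form (p := p) hs hk.le (σ.comp (QuotientGroup.mk' _))
      (fun w hw => by
    have : (QuotientGroup.mk w : GammaTwoModThree G) = 1 := (QuotientGroup.eq_one_iff _).mpr hw
    change σ (QuotientGroup.mk w) = 1
    rw [this, map_one])
  refine ⟨β, hβ, fun u => ?_, fun u hu v => ?_⟩
  · obtain ⟨x, rfl⟩ := hs (Multiplicative.ofAdd u)
    change β (π x).toAdd (π x).toAdd = 0
    rw [hβ]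
    simp only [commutatorElement_self]
    exact congrArg Multiplicative.toAdd (map_one _)
  · obtain ⟨x, rfl⟩ := hs (Multiplicative.ofAdd u)
    obtain ⟨w, rfl⟩ := hs' (Multiplicative.ofAdd v)
    obtain ⟨w, rfl⟩ := QuotientGroup.mk_surjective w
    have hx : x ∉ frattini G := fun h => hu (by rw [← hk] at h; exact h)
    obtain ⟨g, hg⟩ := hG.exists_commutator_eq hx w.2
    refine ⟨(π g).toAdd, ?_⟩
    change β (π x).toAdd (π g).toAdd = _
    rw [hβ]
    simp only [hg]
    rfl

theorem IsCaminaType.two_mul_rank_le (hG : IsCaminaType G) (hp : IsPGroup p G) :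
    2 * Group.rank (GammaTwoModThree G) ≤ Group.rank G := by
  obtain ⟨π, hs, hk⟩ := hp.exists_frattini_coordinates_rank
  obtain ⟨σ, hs', -⟩ := (isPGroup_gammaTwoModThree hp).exists_frattini_coordinates_rank
  obtain ⟨β, -, h0, hsurj⟩ := hG.exists_form (p := p) hs hk hs'
  have := two_mul_finrank_le_of_alternating β h0 hsurj (by simpa using hG.rank_pos)
  simpa using this

/-- Here T records commutation with γ₂, with values in γ₃ ≅ `ZMod p`. Elements of G lying over ker T
centralize γ₂, and T ≠ 0 because γ₃ is nontrivial. If dim V < dim U, then ker T ≠ 0 supplies c. -/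
theorem IsCaminaType.rank_le_and_exists_centralizer (hG : IsCaminaType G) (hp : IsPGroup p G)
    (hc : gammaThree G ≤ center G) (h3 : Nat.card (gammaThree G) = p) :
    Group.rank G ≤ 2 * Group.rank (GammaTwoModThree G) ∧
    (Group.rank (GammaTwoModThree G) < Group.rank G →
      ∃ c, c ∉ frattini G ∧ c ∈ centralizer (gammaTwo G : Set G)) := by
  obtain ⟨π, hs, hk⟩ := hp.exists_frattini_coordinates_rank
  obtain ⟨σ, hs', hk'⟩ := (isPGroup_gammaTwoModThree hp).exists_frattini_coordinates_rank
  obtain ⟨β, hβ, h0, hsurj⟩ := hG.exists_form (p := p) hs hk hs'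
  let μ : gammaThree G ≃* Multiplicative (ZMod p) := mulEquivOfPrimeCardEq (p := p) h3 (by simp)
  obtain ⟨T, hT⟩ := exists_gammaThree_form hs hk.le hs' hk'.le hc μ.toMonoidHom
  have hker : ∀ z, (π z).toAdd ∈ LinearMap.ker T → z ∈ centralizer (gammaTwo G : Set G) := by
    intro z hz
    rw [mem_centralizer_iff]
    intro w hw
    have h1 := hT z ⟨w, hw⟩
    rw [LinearMap.mem_ker.mp hz, LinearMap.zero_apply] at h1
    have h2 := (map_eq_one_iff μ μ.injective).mp h1.symm
    exact commutatorElement_eq_one_iff_mul_comm.mp (congrArg Subtype.val h2)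
  constructor
  · have := finrank_le_two_mul_of_alternating β hsurj T ?_ ?_
    · simpa using this
    · rintro rfl
      have hbot : gammaThree G = ⊥ := by
        rw [eq_bot_iff]
        refine commutator_le.mpr fun w hw z _ => ?_
        rw [mem_bot, commutatorElement_eq_one_iff_mul_comm]
        exact mem_centralizer_iff.mp (hker z (by simp)) w hw
      rw [hbot, card_bot] at h3
      exact (Fact.out : p.Prime).one_lt.ne h3
    · intro u hu v hv w
      obtain ⟨x, rfl⟩ := hs (Multiplicative.ofAdd u)
      obtain ⟨y, rfl⟩ := hs (Multiplicative.ofAdd v)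
      obtain ⟨z, rfl⟩ := hs (Multiplicative.ofAdd w)
      change T (π z).toAdd (β (π x).toAdd (π y).toAdd) = 0
      rw [hβ, hT]
      -- Three subgroups lemma: with C the centralizer of γ₂, [C, G, C] ≤ [γ₂, C] = 1, hence [C, C,
      -- G] = 1. This is the isotropy of ker T.
      have hC := commutator_commutator_eq_bot_of_rotate
        (H₁ := centralizer (gammaTwo G : Set G)) (H₂ := centralizer (gammaTwo G : Set G))
        (H₃ := ⊤)
      have h1 : ⁅⁅centralizer (gammaTwo G : Set G), (⊤ : Subgroup G)⁆,
          centralizer (gammaTwo G : Set G)⁆ = ⊥ := by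
        rw [commutator_eq_bot_iff_le_centralizer, le_centralizer_iff]
        exact centralizer_le (commutator_mono le_top le_rfl)
      have h2 : ⁅⁅(⊤ : Subgroup G), centralizer (gammaTwo G : Set G)⁆,
          centralizer (gammaTwo G : Set G)⁆ = ⊥ := by rw [commutator_comm ⊤]; exact h1
      have hxyz := commutator_mem_commutator
        (commutator_mem_commutator (hker x hu) (hker y hv)) (mem_top z)
      rw [hC h1 h2, mem_bot] at hxyz
      simp only [hxyz]
      exact congrArg Multiplicative.toAdd (map_one μ)
  · intro hlt
    have h1 : LinearMap.ker T ≠ ⊥ := by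
      refine LinearMap.ker_ne_bot_of_finrank_lt ?_
      rw [Subspace.dual_finrank_eq]
      simpa using hlt
    obtain ⟨u, hu, hu0⟩ := (Submodule.ne_bot_iff _).mp h1
    obtain ⟨c, rfl⟩ := hs (Multiplicative.ofAdd u)
    exact ⟨c, fun h => hu0 (by rw [← hk] at h; exact h), hker c hu⟩

end CommutatorForms

/-! ### Reduction to quotients with γ₃ of order p, and the rank formula. -/

section CaminaQuotients

open Subgroup
open scoped commutatorElement

variable {p : ℕ} [Fact p.Prime] {G : Type*} [Group G]

theorem map_mk_lowerCentralSeries (N : Subgroup G) [N.Normal] (n : ℕ) :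
    ((⊤ : Subgroup G).lowerCentralSeries n).map (QuotientGroup.mk' N) =
      (⊤ : Subgroup (G ⧸ N)).lowerCentralSeries n := by
  rw [map_lowerCentralSeries, map_top_of_surjective _ (QuotientGroup.mk'_surjective N)]

theorem map_mk_gammaTwo (N : Subgroup G) [N.Normal] :
    (gammaTwo G).map (QuotientGroup.mk' N) = gammaTwo (G ⧸ N) :=
  map_mk_lowerCentralSeries N 1

theorem map_mk_gammaThree (N : Subgroup G) [N.Normal] :
    (gammaThree G).map (QuotientGroup.mk' N) = gammaThree (G ⧸ N) :=
  map_mk_lowerCentralSeries N 2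

theorem IsCaminaType.quotient (hG : IsCaminaType G) (N : Subgroup G) [N.Normal]
    (hN : ¬ gammaTwo G ≤ N) : IsCaminaType (G ⧸ N) where
  nonabelian := by
    by_contra! h
    apply hN
    refine commutator_le.mpr fun a _ b _ => ?_
    rw [← QuotientGroup.eq_one_iff]
    exact commutatorElement_eq_one_iff_mul_comm.mpr (h a b)
  commutators_eq := by
    intro x hx
    obtain ⟨x, rfl⟩ := QuotientGroup.mk'_surjective N x
    have hx' : x ∉ frattini G := fun h =>
      hx (frattini_le_comap_frattini_of_surjective (QuotientGroup.mk'_surjective N) h)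
    rw [← map_mk_gammaTwo, coe_map, ← hG.commutators_eq x hx']
    ext y
    constructor
    · rintro ⟨g, rfl⟩
      obtain ⟨g, rfl⟩ := QuotientGroup.mk'_surjective N g
      exact ⟨_, ⟨g, rfl⟩, by simp⟩
    · rintro ⟨_, ⟨g, rfl⟩, rfl⟩
      exact ⟨QuotientGroup.mk' N g, by simp⟩

theorem card_gammaTwoModThree_quotient (N : Subgroup G) [N.Normal] (hN : N ≤ gammaThree G) :
    Nat.card (GammaTwoModThree (G ⧸ N)) = Nat.card (GammaTwoModThree G) := by
  change (gammaThree (G ⧸ N)).relIndex (gammaTwo (G ⧸ N)) = (gammaThree G).relIndex (gammaTwo G)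
  rw [← map_mk_gammaTwo, ← relIndex_comap, ← map_mk_gammaThree, comap_map_eq, QuotientGroup.ker_mk',
    sup_eq_left.mpr hN]

theorem rank_gammaTwoModThree_quotient_le [Finite G] (N : Subgroup G) [N.Normal] :
    Group.rank (GammaTwoModThree (G ⧸ N)) ≤ Group.rank (GammaTwoModThree G) := by
  have hmem : ∀ w : gammaTwo G, QuotientGroup.mk' N w ∈ gammaTwo (G ⧸ N) := fun w => by
    rw [← map_mk_gammaTwo]
    exact mem_map_of_mem _ w.2
  let f : gammaTwo G →* gammaTwo (G ⧸ N) :=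
    ((QuotientGroup.mk' N).comp (gammaTwo G).subtype).codRestrict _ hmem
  have hf : Function.Surjective f := by
    rintro ⟨y, hy⟩
    have hy' := hy
    rw [← map_mk_gammaTwo] at hy'
    obtain ⟨w, hw, rfl⟩ := hy'
    exact ⟨⟨w, hw⟩, rfl⟩
  have hle : (gammaThree G).subgroupOf (gammaTwo G) ≤
      ((gammaThree (G ⧸ N)).subgroupOf (gammaTwo (G ⧸ N))).comap f := by
    intro w hw
    change QuotientGroup.mk' N w ∈ gammaThree (G ⧸ N)
    rw [← map_mk_gammaThree]
    exact mem_map_of_mem _ hw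
  refine Group.rank_le_of_surjective (QuotientGroup.map _ _ f hle) ?_
  exact QuotientGroup.map_surjective_of_surjective _ _ _
    ((QuotientGroup.mk'_surjective _).comp hf) _

theorem Subgroup.eq_bot_of_le_commutator_top [Group.IsNilpotent G] {H : Subgroup G}
    (h : H ≤ ⁅H, (⊤ : Subgroup G)⁆) : H = ⊥ := by
  have key : ∀ n, H ≤ (⊤ : Subgroup G).lowerCentralSeries n := by
    intro n
    induction n with
    | zero => exact le_top
    | succ n ih => exact h.trans (commutator_mono ih le_rfl)
  have := key (Group.nilpotencyClass G)
  rwa [lowerCentralSeries_nilpotencyClass, le_bot_iff] at this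

/-- A Nakayama lemma for nilpotent groups, obtained modulo K from the case K = 1. -/
theorem Subgroup.le_of_le_sup_commutator_top [Group.IsNilpotent G] {H K : Subgroup G} [K.Normal]
    (h : H ≤ K ⊔ ⁅H, (⊤ : Subgroup G)⁆) : H ≤ K := by
  have h1 : H.map (QuotientGroup.mk' K) = ⊥ := by
    apply eq_bot_of_le_commutator_top
    refine (map_mono h).trans ?_
    rw [Subgroup.map_sup, map_commutator, map_top_of_surjective _ (QuotientGroup.mk'_surjective K),
      QuotientGroup.map_mk'_self, bot_sup_eq]
  rwa [Subgroup.map_eq_bot_iff, QuotientGroup.ker_mk'] at h1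

/-- Between `γ₄(G)` and `γ₃(G)` there is a subgroup of index `p` in `γ₃(G)`. -/
theorem IsPGroup.exists_normal_card_gammaThree_quotient [Finite G] (hp : IsPGroup p G)
    {M : Subgroup G} (hM : ⁅gammaThree G, (⊤ : Subgroup G)⁆ ≤ M) (hlt : ¬ gammaThree G ≤ M) :
    ∃ (N : Subgroup G) (_ : N.Normal), M ⊓ gammaThree G ≤ N ∧ N ≤ gammaThree G ∧
      Nat.card (gammaThree (G ⧸ N)) = p ∧ gammaThree (G ⧸ N) ≤ center (G ⧸ N) := by
  obtain ⟨K, hMK, hK⟩ := (hp.to_subgroup (gammaThree G)).exists_index_eq_of_ne_top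
    (M := M.subgroupOf (gammaThree G)) (by rwa [Ne, subgroupOf_eq_top])
  have hNle : K.map (gammaThree G).subtype ≤ gammaThree G := map_subtype_le K
  have hMN : M ⊓ gammaThree G ≤ K.map (gammaThree G).subtype := by
    rintro x ⟨hx, hx'⟩
    exact ⟨⟨x, hx'⟩, hMK hx, rfl⟩
  have h4 : ⁅gammaThree G, (⊤ : Subgroup G)⁆ ≤ K.map (gammaThree G).subtype :=
    (le_inf hM (commutator_le_left _ _)).trans hMN
  have hN : (K.map (gammaThree G).subtype).Normal := by
    rw [← commutator_top_right_le_iff]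
    exact (commutator_mono hNle le_rfl).trans h4
  refine ⟨_, hN, hMN, hNle, ?_, ?_⟩
  · rw [← map_mk_gammaThree, ← relIndex_ker, QuotientGroup.ker_mk',
      relIndex, ← hK]
    congr 1
    exact comap_map_eq_self_of_injective (subtype_injective _) K
  · rw [← commutator_top_right_eq_bot_iff_le_center]
    rw [← map_mk_gammaThree,
      ← map_top_of_surjective _ (QuotientGroup.mk'_surjective _), ← map_commutator,
      Subgroup.map_eq_bot_iff, QuotientGroup.ker_mk']
    exact h4

theorem gammaThree_ne_bot [Group.IsNilpotent G] (hclass : 3 ≤ Group.nilpotencyClass G) :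
    gammaThree G ≠ ⊥ := by
  rw [Ne, Subgroup.lowerCentralSeries_eq_bot_iff_nilpotencyClass_le]
  omega

theorem not_gammaTwo_le_of_card_gammaThree_quotient {N : Subgroup G} [N.Normal]
    (h : Nat.card (gammaThree (G ⧸ N)) = p) : ¬ gammaTwo G ≤ N := by
  intro hle
  have hb : gammaThree (G ⧸ N) = ⊥ := by
    rw [← map_mk_gammaThree, Subgroup.map_eq_bot_iff, QuotientGroup.ker_mk']
    exact gammaThree_le_gammaTwo.trans hle
  rw [hb, card_bot] at h
  exact (Fact.out : p.Prime).one_lt.ne h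

/-- Dividing by N ≤ γ₃ ≤ Φ(G) keeps d(G) and does not raise d(γ₂/γ₃), so the upper bound may be
proved when |γ₃| = p. -/
theorem IsCaminaType.rank_eq [Finite G] (hG : IsCaminaType G) (hp : IsPGroup p G)
    (hclass : 3 ≤ Group.nilpotencyClass G) :
    Group.rank G = 2 * Group.rank (GammaTwoModThree G) := by
  have := hp.isNilpotent
  refine le_antisymm ?_ (hG.two_mul_rank_le hp)
  obtain ⟨N, hN, -, hN3, hcard, hcen⟩ := hp.exists_normal_card_gammaThree_quotient le_rfl
    (fun h => gammaThree_ne_bot hclass (eq_bot_of_le_commutator_top h))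
  have hQ := hG.quotient N (not_gammaTwo_le_of_card_gammaThree_quotient hcard)
  have h1 := (hQ.rank_le_and_exists_centralizer (hp.to_quotient N) hcen hcard).1
  rw [rank_quotient_of_le_frattini hp N
    (hN3.trans (gammaThree_le_gammaTwo.trans hp.gammaTwo_le_frattini))] at h1
  exact h1.trans (Nat.mul_le_mul_left 2 (rank_gammaTwoModThree_quotient_le N))

theorem Group.rank_le_one_of_isCyclic (C : Type*) [Group C] [IsCyclic C] [Group.FG C] :
    Group.rank C ≤ 1 := by
  obtain ⟨g, hg⟩ := IsCyclic.exists_generator (α := C)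
  refine (Group.rank_le (S := {g}) ?_).trans (Finset.card_singleton g).le
  rw [Finset.coe_singleton, ← zpowers_eq_closure, eq_top_iff]
  exact fun x _ => hg x

theorem IsCaminaType.rank_eq_two_of_isCyclic [Finite G] (hG : IsCaminaType G) (hp : IsPGroup p G)
    (hclass : 3 ≤ Group.nilpotencyClass G) (hc : IsCyclic (gammaTwo G)) : Group.rank G = 2 := by
  have h1 := hG.rank_eq hp hclass
  have := isCyclic_of_surjective (QuotientGroup.mk' ((gammaThree G).subgroupOf (gammaTwo G)))
    (QuotientGroup.mk'_surjective _)
  have h2 := Group.rank_le_one_of_isCyclic (GammaTwoModThree G)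
  have h3 := hG.rank_pos
  omega

end CaminaQuotients

/-! ### Two generators: γ₂ is cyclic. -/

section TwoGenerators

open Subgroup
open scoped commutatorElement

variable {p : ℕ} [Fact p.Prime] {G : Type*} [Group G] [Finite G]

/-- The bound 2 < q is needed: q = i = 2 gives C(2,2) = 1. -/
theorem prime_dvd_choose_two {k q i : ℕ} (hq : q = p ^ k) (hq2 : 2 < q) (hi : q ∣ i) :
    p ∣ i.choose 2 := by
  have hprime : p.Prime := Fact.out
  have h2 : i.choose 2 * 2 = i * (i - 1) := by
    rw [Nat.choose_two_right]
    exact Nat.div_mul_cancel (Nat.even_mul_pred_self i).two_dvd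
  have hk : k ≠ 0 := by rintro rfl; simp at hq; omega
  have hpi : p ∣ i := (dvd_pow_self p hk).trans (hq ▸ hi)
  by_cases hp2 : p = 2
  · subst hp2
    have hk2 : 2 ≤ k := by
      by_contra! h
      have : k = 1 := by omega
      subst this
      omega
    have h4 : 4 ∣ i.choose 2 * 2 := by
      rw [h2]
      exact ((pow_dvd_pow 2 hk2).trans (hq ▸ hi)).mul_right _
    omega
  · have h : p ∣ i.choose 2 * 2 := h2 ▸ hpi.mul_right _
    refine (hprime.dvd_mul.mp h).resolve_right fun h => hp2 ?_
    exact (Nat.prime_dvd_prime_iff_eq hprime Nat.prime_two).mp h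

/-- If `G = ⟨a, b⟩` and `a` centralizes `γ₂(G)`, then the conjugates of `a` are its conjugates
under powers of `b`. -/
theorem exists_pow_conj_eq {a b : G} (hab : closure {a, b} = (⊤ : Subgroup G))
    (ha : a ∈ centralizer (gammaTwo G : Set G)) (g : G) :
    ∃ i : ℕ, g * a * g⁻¹ = b ^ i * a * (b ^ i)⁻¹ := by
  -- The subgroup ⟨a⟩γ₂ is normal and centralizes a, and G = ⟨b⟩⟨a⟩γ₂, so only the factor from ⟨b⟩
  -- moves a.
  have hN : (zpowers a ⊔ gammaTwo G).Normal := by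
    apply Normal.of_commutator_le
    rw [← top_lowerCentralSeries_one]
    exact le_sup_right
  have htop : zpowers b ⊔ (zpowers a ⊔ gammaTwo G) = ⊤ := by
    rw [eq_top_iff, ← hab, closure_le]
    rintro x (rfl | rfl)
    · exact le_sup_right (a := zpowers b) (le_sup_left (a := zpowers x) (mem_zpowers x))
    · exact le_sup_left (a := zpowers x) (mem_zpowers x)
  have hle : zpowers a ⊔ gammaTwo G ≤ centralizer {a} := by
    refine sup_le ?_ fun w hw => ?_
    · rw [zpowers_le, mem_centralizer_singleton_iff]
    · rw [mem_centralizer_singleton_iff]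
      exact mem_centralizer_iff.mp ha w hw
  obtain ⟨y, hy, d, hd, rfl⟩ := mem_sup_of_normal_right.mp (htop ▸ mem_top g)
  obtain ⟨i, rfl⟩ := mem_powers_iff_mem_zpowers.mpr hy
  refine ⟨i, ?_⟩
  have hda : d * a = a * d := mem_centralizer_singleton_iff.mp (hle hd)
  simp only [mul_inv_rev]
  rw [mul_assoc (b ^ i) d a, hda]
  group

theorem pow_conj_eq_of_central {H : Type*} [Group H] {b c y t : H} (hy : b * c * b⁻¹ = y * c)
    (ht : b * y * b⁻¹ = t * y) (hc : t ∈ center H) (i : ℕ) :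
    b ^ i * c * (b ^ i)⁻¹ = y ^ i * t ^ i.choose 2 * c := by
  have hcomm : ∀ (n : ℕ) (x : H), t ^ n * x = x * t ^ n := fun n x =>
    (mem_center_iff.mp (pow_mem hc n) x).symm
  induction i with
  | zero => simp
  | succ i ih =>
    have h1 : b * t ^ i.choose 2 * b⁻¹ = t ^ i.choose 2 := by
      rw [← hcomm, mul_inv_cancel_right]
    have h2 : b * y ^ i * b⁻¹ = t ^ i * y ^ i := by
      rw [← conj_pow, ht]
      exact (show Commute t y from (mem_center_iff.mp hc y).symm).mul_pow i
    calc b ^ (i + 1) * c * (b ^ (i + 1))⁻¹ = b * (b ^ i * c * (b ^ i)⁻¹) * b⁻¹ := by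
          rw [pow_succ']; group
      _ = (b * y ^ i * b⁻¹) * (b * t ^ i.choose 2 * b⁻¹) * (b * c * b⁻¹) := by rw [ih]; group
      _ = y ^ (i + 1) * t ^ (i + 1).choose 2 * c := by
          rw [h1, h2, hy, Nat.choose_succ_succ' i 1, Nat.choose_one_right, pow_add t, pow_succ y]
          rw [hcomm i (y ^ i), mul_assoc (y ^ i), ← pow_add, ← mul_assoc, mul_assoc (y ^ i) _ y,
            hcomm _ y, ← mul_assoc]

/-- In the case `|γ₃(G)| = p`, the elements of `γ₃(G)` are `p`-th powers of elements of `γ₂(G)`. -/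
theorem IsCaminaType.exists_pow_eq_of_mem_gammaThree (hG : IsCaminaType G) (hp : IsPGroup p G)
    (hc : gammaThree G ≤ center G) (h3 : Nat.card (gammaThree G) = p) (hr : Group.rank G = 2)
    (hcard : 2 < Nat.card (GammaTwoModThree G)) {s : G} (hs : s ∈ gammaThree G) :
    ∃ w ∈ gammaTwo G, s = w ^ p := by
  have hrA := hG.two_mul_rank_le hp
  obtain ⟨c, hcf, hcc⟩ := (hG.rank_le_and_exists_centralizer hp hc h3).2 (by omega)
  obtain ⟨b, hcb⟩ := hp.exists_closure_pair_eq_top hr hcf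
  set y := ⁅b, c⁆ with hy
  have hy2 : y ∈ gammaTwo G := commutatorElement_mem_gammaTwo b c
  set t := ⁅b, y⁆ with ht
  have ht3 : t ∈ gammaThree G := commutatorElement_mem_gammaThree' hy2 b
  -- By the Camina condition w⁻¹ = ⁅c, g⁆, and only powers of b matter for g. So y generates γ₂
  -- modulo γ₃, and w ∈ γ₃ forces |γ₂/γ₃| to divide i; then p divides C(i,2) and the factor in t
  -- vanishes.
  have key : ∀ w ∈ gammaTwo G, ∃ i : ℕ, w = y ^ i * t ^ i.choose 2 := by
    intro w hw
    obtain ⟨g, hg⟩ := hG.exists_commutator_eq hcf (inv_mem hw)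
    obtain ⟨i, hi⟩ := exists_pow_conj_eq hcb hcc g
    refine ⟨i, ?_⟩
    rw [pow_conj_eq_of_central (y := y) (t := t) (by simp [hy, commutatorElement_def])
      (by simp [ht, commutatorElement_def]) (hc ht3)] at hi
    rw [← mul_left_inj c, ← hi, ← inv_inv w, ← hg, commutatorElement_inv, commutatorElement_def]
    group
  let A := GammaTwoModThree G
  let yA : A := QuotientGroup.mk ⟨y, hy2⟩
  have hmk : ∀ w : gammaTwo G, (QuotientGroup.mk w : A) = 1 ↔ (w : G) ∈ gammaThree G :=
    fun w => QuotientGroup.eq_one_iff w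
  have hmk' : ∀ (w : gammaTwo G) (i n : ℕ), (w : G) = y ^ i * t ^ n →
      (QuotientGroup.mk w : A) = yA ^ i := by
    intro w i n h
    have hw : w = ⟨y, hy2⟩ ^ i * ⟨t, gammaThree_le_gammaTwo ht3⟩ ^ n := Subtype.ext h
    rw [hw, QuotientGroup.mk_mul, QuotientGroup.mk_pow, QuotientGroup.mk_pow,
      (hmk ⟨t, _⟩).mpr ht3, one_pow, mul_one]
  have hord : orderOf yA = Nat.card A := by
    apply orderOf_eq_card_of_forall_mem_zpowers
    intro x
    obtain ⟨w, rfl⟩ := QuotientGroup.mk_surjective x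
    obtain ⟨i, hi⟩ := key w w.2
    rw [hmk' w i _ hi]
    exact pow_mem (mem_zpowers _) i
  obtain ⟨k, hk⟩ := IsPGroup.iff_card.mp (isPGroup_gammaTwoModThree hp)
  obtain ⟨i, hi⟩ := key s (gammaThree_le_gammaTwo hs)
  have hdvd : Nat.card A ∣ i := by
    rw [← hord]
    apply orderOf_dvd_of_pow_eq_one
    rw [← hmk' ⟨s, gammaThree_le_gammaTwo hs⟩ i _ hi, hmk]
    exact hs
  have htp : t ^ p = 1 := by
    have : (⟨t, ht3⟩ : gammaThree G) ^ p = 1 := by rw [← h3]; exact pow_card_eq_one'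
    exact congrArg Subtype.val this
  obtain ⟨m, hm⟩ := prime_dvd_choose_two hk hcard hdvd
  have hpi : p ∣ i := by
    refine dvd_trans ?_ hdvd
    rw [hk]
    refine dvd_pow_self p ?_
    rintro rfl
    rw [hk] at hcard
    simp at hcard
  obtain ⟨j, rfl⟩ := hpi
  refine ⟨y ^ j, pow_mem hy2 j, ?_⟩
  rw [hi, hm, pow_mul t, htp, one_pow, mul_one, ← pow_mul, mul_comm]

/-- Otherwise some quotient by N, with N containing Φ(γ₂) ∩ γ₃, has γ₃ of order p. There γ₃ consists
of p-th powers from γ₂; these lift into Φ(γ₂) ∩ γ₃ ≤ N, so γ₃ would be trivial. -/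
theorem IsCaminaType.gammaThree_le_map_frattini (hG : IsCaminaType G) (hp : IsPGroup p G)
    (hr : Group.rank G = 2) (hcard : 2 < Nat.card (GammaTwoModThree G)) :
    gammaThree G ≤ (frattini (gammaTwo G)).map (gammaTwo G).subtype := by
  have := hp.isNilpotent
  set K := (frattini (gammaTwo G)).map (gammaTwo G).subtype with hK
  by_contra hle
  obtain ⟨N, hN, hMN, hN3, hcN, hcen⟩ := hp.exists_normal_card_gammaThree_quotient
    (M := K ⊔ ⁅gammaThree G, (⊤ : Subgroup G)⁆) le_sup_right
    (fun h => hle (le_of_le_sup_commutator_top h))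
  have hQ := hG.quotient N (not_gammaTwo_le_of_card_gammaThree_quotient hcN)
  have hrQ := rank_quotient_of_le_frattini hp N
    (hN3.trans (gammaThree_le_gammaTwo.trans hp.gammaTwo_le_frattini))
  have hcQ := card_gammaTwoModThree_quotient N hN3
  have hbot : gammaThree (G ⧸ N) = ⊥ := by
    rw [← map_mk_gammaThree, Subgroup.map_eq_bot_iff, QuotientGroup.ker_mk']
    intro t ht
    have htQ : QuotientGroup.mk' N t ∈ gammaThree (G ⧸ N) := by
      rw [← map_mk_gammaThree]
      exact mem_map_of_mem _ ht
    obtain ⟨w, hw, hwt⟩ := hQ.exists_pow_eq_of_mem_gammaThree (hp.to_quotient N) hcen hcN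
      (hrQ.trans hr) (hcQ ▸ hcard) htQ
    rw [← map_mk_gammaTwo] at hw
    obtain ⟨w, hw, rfl⟩ := hw
    rw [← map_pow] at hwt
    have h1 : t⁻¹ * w ^ p ∈ N := QuotientGroup.eq.mp hwt
    have h2 : w ^ p ∈ K := ⟨⟨w, hw⟩ ^ p, (hp.to_subgroup _).pow_mem_frattini _, rfl⟩
    have h3 : w ^ p ∈ gammaThree G := by
      have := mul_mem ht (hN3 h1)
      rwa [mul_inv_cancel_left] at this
    have h4 : w ^ p ∈ N := hMN ⟨le_sup_left (a := K) h2, h3⟩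
    have h5 := mul_mem h4 (inv_mem h1)
    simpa using h5
  rw [hbot, card_bot] at hcN
  exact (Fact.out : p.Prime).one_lt.ne hcN

theorem IsCaminaType.isCyclic_gammaTwo (hG : IsCaminaType G) (hp : IsPGroup p G)
    (hr : Group.rank G = 2) (hcard : 2 < Nat.card (GammaTwoModThree G)) :
    IsCyclic (gammaTwo G) := by
  have hrA := hG.two_mul_rank_le hp
  obtain ⟨S, hS, hS'⟩ := Group.rank_spec (GammaTwoModThree G)
  obtain ⟨x, hx⟩ : ∃ x : GammaTwoModThree G, zpowers x = ⊤ := by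
    rcases Nat.le_one_iff_eq_zero_or_eq_one.mp (show S.card ≤ 1 by omega) with h | h
    · rw [Finset.card_eq_zero.mp h, Finset.coe_empty, Subgroup.closure_empty] at hS'
      exact ⟨1, by rw [zpowers_one_eq_bot, hS']⟩
    · obtain ⟨x, rfl⟩ := Finset.card_eq_one.mp h
      exact ⟨x, by rw [zpowers_eq_closure, ← hS', Finset.coe_singleton]⟩
  obtain ⟨y, rfl⟩ := QuotientGroup.mk'_surjective _ x
  have htop : zpowers y = ⊤ := by
    apply frattini_nongenerating
    rw [eq_top_iff]
    have h1 : (gammaThree G).subgroupOf (gammaTwo G) ≤ frattini (gammaTwo G) := by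
      intro w hw
      obtain ⟨v, hv, hvw⟩ := hG.gammaThree_le_map_frattini hp hr hcard hw
      rwa [← Subtype.ext hvw]
    refine le_trans ?_ (sup_le_sup_left h1 _)
    nth_rw 1 [← QuotientGroup.ker_mk' ((gammaThree G).subgroupOf (gammaTwo G))]
    rw [← comap_map_eq, MonoidHom.map_zpowers, hx, comap_top]
  exact ⟨y, fun w => (htop ▸ mem_top w : w ∈ zpowers y)⟩

end TwoGenerators

/-! ### The action of G on a cyclic γ₂, and Hypothesis A. -/

section HypothesisA

open Subgroup
open scoped commutatorElement

variable {p : ℕ} [Fact p.Prime] {G : Type*} [Group G]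

theorem exists_conj_eq_zpow_of_isCyclic {N : Subgroup G} [N.Normal] {y : G} (hy : y ∈ N)
    (hgen : ∀ w ∈ N, w ∈ zpowers y) (g : G) : ∃ r : ℤ, ∀ i : ℤ, g * y ^ i * g⁻¹ = y ^ (r * i) := by
  obtain ⟨r, hr⟩ := mem_zpowers_iff.mp (hgen _ (Normal.conj_mem ‹_› y hy g))
  exact ⟨r, fun i => by rw [← conj_zpow, ← hr, zpow_mul]⟩

variable [Finite G]

/-- If `γ₂(G)` is cyclic, `G / C_G(γ₂(G))` is cyclic, so `C_G(γ₂(G))` is not contained in the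
Frattini subgroup. -/
theorem IsCaminaType.exists_centralizer_of_isCyclic (hG : IsCaminaType G) (hp : IsPGroup p G)
    (hclass : 3 ≤ Group.nilpotencyClass G) (hcard : 2 < Nat.card (GammaTwoModThree G))
    (hcyc : IsCyclic (gammaTwo G)) :
    ∃ a, a ∉ frattini G ∧ a ∈ centralizer (gammaTwo G : Set G) := by
  have hprime : p.Prime := Fact.out
  have hnil := hp.isNilpotent
  obtain ⟨⟨y, hy⟩, hgen'⟩ := IsCyclic.exists_generator (α := gammaTwo G)
  have hgen : ∀ w ∈ gammaTwo G, w ∈ zpowers y := fun w hw => by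
    obtain ⟨i, hi⟩ := mem_zpowers_iff.mp (hgen' ⟨w, hw⟩)
    exact mem_zpowers_iff.mpr ⟨i, congrArg Subtype.val hi⟩
  obtain ⟨k, hk⟩ := IsPGroup.iff_card.mp (isPGroup_gammaTwoModThree hp)
  obtain ⟨n, hn⟩ := IsPGroup.iff_card.mp (hp.to_subgroup (gammaThree G))
  have hn0 : n ≠ 0 := by
    rintro rfl
    rw [pow_zero] at hn
    exact gammaThree_ne_bot hclass (eq_bot_of_card_eq _ hn)
  have hordy : orderOf y = p ^ (n + k) := by
    have h1 := orderOf_eq_card_of_forall_mem_zpowers hgen'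
    rw [Subgroup.orderOf_mk, card_eq_card_quotient_mul_card_subgroup
      ((gammaThree G).subgroupOf (gammaTwo G)), hk,
      Nat.card_congr (subgroupOfEquivOfLe gammaThree_le_gammaTwo).toEquiv, hn] at h1
    rw [h1, pow_add, mul_comm]
  let yA : GammaTwoModThree G := QuotientGroup.mk ⟨y, hy⟩
  have hordA : orderOf yA = p ^ k := by
    rw [← hk]
    apply orderOf_eq_card_of_forall_mem_zpowers
    intro x
    obtain ⟨w, rfl⟩ := QuotientGroup.mk_surjective x
    obtain ⟨i, hi⟩ := mem_zpowers_iff.mp (hgen' w)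
    exact mem_zpowers_iff.mpr ⟨i, by rw [← hi]; rfl⟩
  have hdvd : ∀ e : ℤ, y ^ e ∈ gammaThree G → ((p ^ k : ℕ) : ℤ) ∣ e := by
    intro e he
    rw [← hordA, orderOf_dvd_iff_zpow_eq_one]
    exact (QuotientGroup.eq_one_iff ((⟨y, hy⟩ : gammaTwo G) ^ e)).mpr he
  -- Since γ₃ has order p^n and y has order p^(n+k), the commutators ⁅g, y⁆ cannot all lie in
  -- ⟨y^(p^(k+1))⟩, of order at most p^(n-1).
  obtain ⟨b, hb⟩ : ∃ b, ⁅b, y⁆ ∉ zpowers (y ^ p ^ (k + 1)) := by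
    by_contra! h
    have hle : gammaThree G ≤ zpowers (y ^ p ^ (k + 1)) := by
      refine commutator_le.mpr fun w hw g _ => ?_
      obtain ⟨i, rfl⟩ := mem_zpowers_iff.mp (hgen w hw)
      obtain ⟨j, hj⟩ := mem_zpowers_iff.mp (h g)
      have hconj : g * y ^ i * g⁻¹ = ((y ^ p ^ (k + 1)) ^ j) ^ i * y ^ i := by
        have h1 : g * y * g⁻¹ = (y ^ p ^ (k + 1)) ^ j * y := by
          rw [hj, commutatorElement_def, inv_mul_cancel_right]
        rw [← conj_zpow, h1]
        have : Commute ((y ^ p ^ (k + 1)) ^ j) y := ((Commute.refl y).pow_left _).zpow_left _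
        exact this.mul_zpow i
      rw [← inv_mem_iff, commutatorElement_inv, commutatorElement_def, hconj, mul_inv_cancel_right]
      exact zpow_mem (zpow_mem (mem_zpowers _) _) _
    have h1 := Nat.card_le_card_of_injective _ (inclusion_injective hle)
    have h2 : orderOf (y ^ p ^ (k + 1)) ≤ p ^ (n - 1) := by
      apply orderOf_le_of_pow_eq_one (pow_pos hprime.pos _)
      rw [← pow_mul, ← pow_add, show k + 1 + (n - 1) = n + k by omega, ← hordy, pow_orderOf_eq_one]
    rw [hn, Nat.card_zpowers] at h1
    have h3 := (Nat.pow_le_pow_iff_right hprime.one_lt).mp (h1.trans h2)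
    omega
  have hby3 : ∀ g, ⁅g, y⁆ ∈ gammaThree G := commutatorElement_mem_gammaThree' hy
  obtain ⟨e, he⟩ := mem_zpowers_iff.mp (hgen _ (commutatorElement_mem_gammaTwo b y))
  obtain ⟨a, rfl⟩ := hdvd e (he ▸ hby3 b)
  have hpa : ¬ (p : ℤ) ∣ a := by
    rintro ⟨a, rfl⟩
    apply hb
    rw [← he, mem_zpowers_iff]
    refine ⟨a, ?_⟩
    rw [← zpow_natCast, ← zpow_mul]
    congr 1
    push_cast
    ring
  have hk0 : k ≠ 0 := by
    rintro rfl
    rw [hk, pow_zero] at hcard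
    omega
  -- This excludes only p = 2, k = 1, which is |γ₂/γ₃| = 2. It makes 1 + p^k a of order exactly p^n
  -- modulo p^(n+k).
  have hpk : k + 2 ≤ p * k := by
    rcases hprime.two_le.eq_or_lt with h2 | h2
    · subst h2
      have : k ≠ 1 := by
        rintro rfl
        rw [hk] at hcard
        omega
      omega
    · have := Nat.mul_le_mul_right k (Nat.succ_le_of_lt h2)
      omega
  have hord := ZMod.orderOf_one_add_mul_prime_pow hprime k hk0 hpk a hpa n
  have hpow : ∀ i : ℕ, b ^ i * y * (b ^ i)⁻¹ = y ^ ((1 + (p ^ k : ℕ) * a) ^ i : ℤ) := by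
    intro i
    induction i with
    | zero => simp
    | succ i ih =>
      have h1 : b * y * b⁻¹ = y ^ (1 + (p ^ k : ℕ) * a : ℤ) := by
        rw [add_comm, zpow_add, he, commutatorElement_def, zpow_one, inv_mul_cancel_right]
      calc b ^ (i + 1) * y * (b ^ (i + 1))⁻¹ = b * (b ^ i * y * (b ^ i)⁻¹) * b⁻¹ := by
            rw [pow_succ']; group
        _ = _ := by rw [ih, ← conj_zpow, h1, ← zpow_mul, pow_succ']
  have hinj : Function.Injective fun i : Fin (p ^ n) =>
      (⟨⁅b ^ (i : ℕ), y⁆, hby3 _⟩ : gammaThree G) := by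
    intro i j hij
    have h1 : ⁅b ^ (i : ℕ), y⁆ = ⁅b ^ (j : ℕ), y⁆ := congrArg Subtype.val hij
    rw [commutatorElement_def, commutatorElement_def, mul_left_inj, hpow, hpow,
      zpow_eq_zpow_iff_modEq, hordy, ← ZMod.intCast_eq_intCast_iff] at h1
    push_cast at h1
    exact Fin.ext (pow_injOn_Iio_orderOf (by rw [hord]; exact i.2) (by rw [hord]; exact j.2) h1)
  -- The ⁅b^i, y⁆ with i < p^n fill γ₃, so every g acts on γ₂ as some b^i. If the centralizer of γ₂
  -- were inside Φ(G), then G = ⟨b⟩Φ(G) would be cyclic.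
  have hsurj := (hinj.bijective_of_nat_card_le (by rw [hn, Nat.card_fin])).2
  by_contra! hno
  have hgenb : zpowers b = ⊤ := by
    apply frattini_nongenerating
    rw [eq_top_iff]
    intro g _
    obtain ⟨i, hi⟩ := hsurj ⟨⁅g, y⁆, hby3 g⟩
    have h1 : ⁅b ^ (i : ℕ), y⁆ = ⁅g, y⁆ := congrArg Subtype.val hi
    rw [commutatorElement_def, commutatorElement_def, mul_left_inj] at h1
    have h2 : (b ^ (i : ℕ))⁻¹ * g ∈ frattini G := by
      by_contra hnf
      refine hno _ hnf (mem_centralizer_iff.mpr fun w hw => ?_)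
      obtain ⟨j, rfl⟩ := mem_zpowers_iff.mp (hgen w hw)
      have h3 : Commute y ((b ^ (i : ℕ))⁻¹ * g) := by
        change y * ((b ^ (i : ℕ))⁻¹ * g) = (b ^ (i : ℕ))⁻¹ * g * y
        calc y * ((b ^ (i : ℕ))⁻¹ * g)
            = (b ^ (i : ℕ))⁻¹ * (b ^ (i : ℕ) * y * (b ^ (i : ℕ))⁻¹) * g := by group
          _ = _ := by rw [h1]; group
      exact h3.zpow_left j
    have h3 := mul_mem (le_sup_left (a := zpowers b) (b := frattini G) (pow_mem (mem_zpowers b) i))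
      (le_sup_right (a := zpowers b) h2)
    rwa [mul_inv_cancel_left] at h3
  obtain ⟨u, v, huv⟩ := hG.nonabelian
  obtain ⟨i, rfl⟩ := mem_zpowers_iff.mp (hgenb ▸ mem_top u)
  obtain ⟨j, rfl⟩ := mem_zpowers_iff.mp (hgenb ▸ mem_top v)
  exact huv (zpow_mul_comm b i j)

/-- Since a centralizes γ₂, ⁅a^j, b⁆ = z^j. The subgroup ⟨z⟩ of the cyclic γ₂ is stable under b, so
it contains every ⁅b^i, a⁆, and these exhaust γ₂ by the Camina condition. -/
theorem IsCaminaType.exists_commutator_pow_eq (hG : IsCaminaType G) (hcyc : IsCyclic (gammaTwo G))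
    {a b : G} (hab : closure {a, b} = (⊤ : Subgroup G)) (haf : a ∉ frattini G)
    (hac : a ∈ centralizer (gammaTwo G : Set G)) {w : G} (hw : w ∈ gammaTwo G) :
    ∃ j : ℕ, ⁅a ^ j, b⁆ = w := by
  set z := ⁅a, b⁆ with hz
  have hz2 : z ∈ gammaTwo G := commutatorElement_mem_gammaTwo a b
  obtain ⟨⟨y, hy⟩, hgen'⟩ := IsCyclic.exists_generator (α := gammaTwo G)
  have hgen : ∀ w ∈ gammaTwo G, w ∈ zpowers y := fun w hw => by
    obtain ⟨i, hi⟩ := mem_zpowers_iff.mp (hgen' ⟨w, hw⟩)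
    exact mem_zpowers_iff.mpr ⟨i, congrArg Subtype.val hi⟩
  have hpow : ∀ j : ℕ, a ^ j * b * (a ^ j)⁻¹ = z ^ j * b := by
    intro j
    induction j with
    | zero => simp
    | succ j ih =>
      have h1 : z ^ j * a = a * z ^ j := mem_centralizer_iff.mp hac _ (pow_mem hz2 j)
      calc a ^ (j + 1) * b * (a ^ (j + 1))⁻¹ = a * (a ^ j * b * (a ^ j)⁻¹) * a⁻¹ := by
            rw [pow_succ']; group
        _ = z ^ j * (a * b * a⁻¹) := by rw [ih, ← mul_assoc, ← h1]; group
        _ = _ := by rw [pow_succ, hz, commutatorElement_def]; group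
  obtain ⟨r, hr⟩ := exists_conj_eq_zpow_of_isCyclic hy hgen b
  have hconj : ∀ v ∈ zpowers z, b * v * b⁻¹ ∈ zpowers z := by
    intro v hv
    obtain ⟨m, hm⟩ := mem_zpowers_iff.mp (hgen z hz2)
    obtain ⟨i, rfl⟩ := mem_zpowers_iff.mp hv
    rw [← hm, ← zpow_mul, hr, mul_comm, zpow_mul, zpow_mul]
    exact zpow_mem (zpow_mem (mem_zpowers _) _) _
  have hb : ∀ i : ℕ, ⁅b ^ i, a⁆ ∈ zpowers z := by
    intro i
    induction i with
    | zero => simp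
    | succ i ih =>
      have h1 : ⁅b ^ (i + 1), a⁆ = b * ⁅b ^ i, a⁆ * b⁻¹ * z⁻¹ := by
        rw [hz, commutatorElement_inv]
        simp only [commutatorElement_def]
        rw [pow_succ']
        group
      rw [h1]
      exact mul_mem (hconj _ ih) (inv_mem (mem_zpowers z))
  have hwz : w ∈ zpowers z := by
    obtain ⟨g, hg⟩ := hG.exists_commutator_eq haf (inv_mem hw)
    obtain ⟨i, hi⟩ := exists_pow_conj_eq hab hac g
    have h1 : w = ⁅b ^ i, a⁆ := by
      rw [commutatorElement_def, ← hi, ← commutatorElement_def, ← commutatorElement_inv, hg, inv_inv]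
    rw [h1]
    exact hb i
  obtain ⟨j, rfl⟩ := mem_powers_iff_mem_zpowers.mpr hwz
  exact ⟨j, by rw [commutatorElement_def, hpow, mul_inv_cancel_right]⟩

/-- An automorphism in Aut_c(G) is determined by its values on a and b, giving an injection into γ₂
× γ₂. Inner automorphisms already hit everything: h sends a to ua, and a preliminary conjugation by
a^j, which fixes a, corrects the image of b. -/
theorem IsCaminaType.hypothesisA (hG : IsCaminaType G) (hp : IsPGroup p G)
    (hclass : 3 ≤ Group.nilpotencyClass G) (hr : Group.rank G = 2)
    (hcard : 2 < Nat.card (GammaTwoModThree G)) (hcyc : IsCyclic (gammaTwo G)) :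
    HypothesisA G := by
  obtain ⟨a, haf, hac⟩ := hG.exists_centralizer_of_isCyclic hp hclass hcard hcyc
  obtain ⟨b, hab⟩ := hp.exists_closure_pair_eq_top hr haf
  have hmem : ∀ (α : classPreservingAut G) (x : G), α.1 x * x⁻¹ ∈ gammaTwo G := by
    intro α x
    obtain ⟨g, hg⟩ := isConj_iff.mp (α.2 x)
    rw [← hg]
    exact commutatorElement_mem_gammaTwo g x
  let F : classPreservingAut G → gammaTwo G × gammaTwo G :=
    fun α => (⟨α.1 a * a⁻¹, hmem α a⟩, ⟨α.1 b * b⁻¹, hmem α b⟩)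
  have hF : Function.Bijective F := by
    constructor
    · intro α β h
      have ha : α.1 a = β.1 a := mul_right_cancel (congrArg (fun q => (q.1 : G)) h)
      have hb : α.1 b = β.1 b := mul_right_cancel (congrArg (fun q => (q.2 : G)) h)
      apply Subtype.ext
      apply MulEquiv.toMonoidHom_injective
      refine MonoidHom.eq_of_eqOn_dense hab ?_
      rintro x (rfl | rfl)
      · exact ha
      · exact hb
    · rintro ⟨⟨u, hu⟩, ⟨v, hv⟩⟩
      obtain ⟨h, hh⟩ := hG.exists_commutator_eq haf (inv_mem hu)
      -- This is ⁅a^j, b⁆ as forced by requiring that h a^j conjugate b to vb.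
      have hw : h⁻¹ * (v * ⁅h, b⁆⁻¹) * h⁻¹⁻¹ ∈ gammaTwo G :=
        Normal.conj_mem inferInstance _
          (mul_mem hv (inv_mem (commutatorElement_mem_gammaTwo h b))) _
      obtain ⟨j, hj⟩ := hG.exists_commutator_pow_eq hcyc hab haf hac hw
      have hha : h * a * h⁻¹ * a⁻¹ = u := by
        rw [← commutatorElement_def, ← commutatorElement_inv, hh, inv_inv]
      have hjb : a ^ j * b * (a ^ j)⁻¹ = h⁻¹ * (v * ⁅h, b⁆⁻¹) * h * b := by
        rw [inv_inv] at hj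
        rw [← mul_inv_eq_iff_eq_mul, ← commutatorElement_def, hj]
      refine ⟨⟨MulAut.conj (h * a ^ j), fun x => isConj_iff.mpr ⟨h * a ^ j, rfl⟩⟩, ?_⟩
      refine Prod.ext (Subtype.ext ?_) (Subtype.ext ?_)
      · change h * a ^ j * a * (h * a ^ j)⁻¹ * a⁻¹ = u
        rw [← hha, mul_assoc h, ← pow_succ, pow_succ']
        group
      · change h * a ^ j * b * (h * a ^ j)⁻¹ * b⁻¹ = v
        calc h * a ^ j * b * (h * a ^ j)⁻¹ * b⁻¹
            = h * (a ^ j * b * (a ^ j)⁻¹) * h⁻¹ * b⁻¹ := by group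
          _ = v := by rw [hjb, commutatorElement_def]; group
  rw [HypothesisA, hr, Nat.card_eq_of_bijective F hF, Nat.card_prod, sq]

end HypothesisA

theorem theoremC (p : ℕ) [Fact p.Prime] (G : Type*) [Group G] [Finite G]
    (hp : IsPGroup p G) (hG : IsCaminaType G)
    (hclass : 3 ≤ Group.nilpotencyClass G) :
    (Group.rank G = 2 * Group.rank (GammaTwoModThree G) ∧ Even (Group.rank G)) ∧
    (IsCyclic (gammaTwo G) → Group.rank G = 2) ∧
    (Group.rank G = 2 → 2 < Nat.card (GammaTwoModThree G) →
      IsCyclic (gammaTwo G) ∧ HypothesisA G) := by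
  have hrank := hG.rank_eq hp hclass
  refine ⟨⟨hrank, hrank ▸ even_two_mul _⟩, hG.rank_eq_two_of_isCyclic hp hclass,
    fun hr hcard => ?_⟩
  have hcyc := hG.isCyclic_gammaTwo hp hr hcard
  exact ⟨hcyc, hG.hypothesisA hp hclass hr hcard hcyc⟩
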